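/- Let $p,d\in\mathbb N$, $B\in\mathbb R^{p\times d}$, $\gamma\in\mathbb R^d$, $\alpha\in\mathbb R^p$, and let $N_Z\sim\mathcal N(0,\Sigma_Z)$ on $\mathbb R^d$, $N_X\sim\mathcal N(0,\Sigma_X)$ on $\mathbb R^p$ and $N_Y\sim\mathcal N(0,\sigma_Y^2)$ on $\mathbb R$ be independent. Let $P_{\mathrm{obs}}$ be the law of $(X,Y)$ in the linear Gaussian model $$Z=N_Z,\qquad X=BZ+N_X,\qquad Y=Z^\top\gamma+X^\top\alpha+N_Y,$$ and let $P_{\mathrm{int}}$ be the law of $(X,Y)$ when the second equation is replaced by $X=\widetilde N_X$, where $\widetilde N_X$ is independent of $(N_Z,N_Y)$ and has an arbitrary law on $\mathbb R^p$ with finite second moment. On some probability space let $(x^O_i,y^O_i)_{i\ge 1}\sim P_{\mathrm{obs}}$ and $(x^I_i,y^I_i)_{i\ge1}\sim P_{\mathrm{int}}$ be two i.i.d. sequences, independent of each other. For $n:\mathbb N\to\mathbb N$ and each $m$, let $X_O\in\mathbb R^{n(m)\times p}$, $Y_O\in\mathbb R^{n(m)}$ be formed from the first $n(m)$ observational data points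 (one row per data point) and $X_I\in\mathbb R^{m\times p}$, $Y_I\in\mathbb R^{m}$ from the first $m$ interventional ones. Let $X_P\in\mathbb R^{(n(m)+m)\times p}$ and $Y_P\in\mathbb R^{n(m)+m}$ be the matrix $X_O$ stacked on $X_I$ and the vector $Y_O$ stacked on $Y_I$, and define $$\widehat\alpha_I^m=(X_I^\top X_I)^{-1}X_I^\top Y_I,\qquad \widehat\alpha_P^m=(X_P^\top X_P)^{-1}X_P^\top Y_P,\qquad W_P^m=(X_O^\top X_O+X_I^\top X_I)^{-1}X_I^\top X_I,$$ and $\mathrm{MSE}(\widehat\alpha)=\mathbb E\big[\|\widehat\alpha-\alpha\|_2^2\big]\in[0,\infty]$. Assume that for at least one sample size $m_0$ the purely interventional estimator is well defined and has finite error, that is, $X_I^\top X_I$ is almost surely invertible and $\mathrm{MSE}(\widehat\alpha_I^{m_0})<\infty$. Suppose that $\lim_{m\to\infty} n(m)/m=0$. Then for all sufficiently large $m$ the matrix $X_P^\top X_P$ is almost surely invertible, so that $\widehat\alpha_P^m$ is well defined; $$W_P^m\to I_p\quad\text{almost surely as }m\to\infty;\qquad\text{and}\qquad \lim_{m\to\infty}\mathrm{MSE}(\widehat\alpha_P^m)=0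 .$$ -/

import Mathlib

open MeasureTheory ProbabilityTheory Filter Topology
open scoped ENNReal NNReal Matrix

noncomputable section

/-- The parameters of the linear Gaussian structural equation model
`Z ← N_Z`, `X ← B Z + N_X`, `Y ← Zᵀ γ + Xᵀ α + N_Y` with `d`-dimensional confounder `Z`,
`p`-dimensional treatment `X` and scalar outcome `Y`; the noise variables `N_Z`, `N_X`, `N_Y` are
independent, centred and Gaussian, with (co)variances `covZ`, `covX`, `varY`. -/
structure LinearGaussianSEM (p d : ℕ) where
  B : Matrix (Fin p) (Fin d) ℝ
  γ : EuclideanSpace ℝ (Fin d)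
  α : EuclideanSpace ℝ (Fin p)
  covZ : Matrix (Fin d) (Fin d) ℝ
  covZ_posSemidef : covZ.PosSemidef
  covX : Matrix (Fin p) (Fin p) ℝ
  covX_posSemidef : covX.PosSemidef
  varY : ℝ≥0

namespace LinearGaussianSEM

variable {p d : ℕ} (M : LinearGaussianSEM p d)

/-- The law of the confounder `Z = N_Z`. -/
def lawZ : Measure (EuclideanSpace ℝ (Fin d)) := multivariateGaussian 0 M.covZ

/-- The law of the treatment noise `N_X`. -/
def lawNX : Measure (EuclideanSpace ℝ (Fin p)) := multivariateGaussian 0 M.covX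

/-- The law of the outcome noise `N_Y`. -/
def lawNY : Measure ℝ := gaussianReal 0 M.varY

/-- The structural assignment of the treatment in the observational model. -/
def treatment (z : EuclideanSpace ℝ (Fin d)) (e : EuclideanSpace ℝ (Fin p)) :
    EuclideanSpace ℝ (Fin p) :=
  WithLp.toLp 2 (M.B *ᵥ z.ofLp) + e

/-- The structural assignment of the outcome, in both models. -/
def outcome (z : EuclideanSpace ℝ (Fin d)) (x : EuclideanSpace ℝ (Fin p)) (e : ℝ) : ℝ :=
  (∑ k, z k * M.γ k) + (∑ j, x j * M.α j) + e

/-- The observational distribution of `(X, Y)`. -/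
def obsLaw : Measure (EuclideanSpace ℝ (Fin p) × ℝ) :=
  (M.lawZ.prod (M.lawNX.prod M.lawNY)).map
    (fun u => (M.treatment u.1 u.2.1, M.outcome u.1 (M.treatment u.1 u.2.1) u.2.2))

/-- The interventional distribution of `(X, Y)`: the assignment of the treatment is replaced by
`X ← Ñ_X`, where `Ñ_X` has law `Q` and is independent of the other noise variables. -/
def intLaw (Q : Measure (EuclideanSpace ℝ (Fin p))) : Measure (EuclideanSpace ℝ (Fin p) × ℝ) :=
  (M.lawZ.prod (Q.prod M.lawNY)).map (fun u => (u.2.1, M.outcome u.1 u.2.1 u.2.2))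

end LinearGaussianSEM

/-- The treatment matrix of a sample `(x_i, y_i)_{i < n}`: its rows are the `x_iᵀ`. -/
def treatmentMatrix {p n : ℕ} (s : Fin n → EuclideanSpace ℝ (Fin p) × ℝ) :
    Matrix (Fin n) (Fin p) ℝ :=
  Matrix.of fun i j => (s i).1 j

/-- The outcome vector of a sample `(x_i, y_i)_{i < n}`. -/
def outcomeVector {p n : ℕ} (s : Fin n → EuclideanSpace ℝ (Fin p) × ℝ) : Fin n → ℝ :=
  fun i => (s i).2

/-- The ordinary least-squares estimator `(Xᵀ X)⁻¹ Xᵀ y` (meaningful when `Xᵀ X` is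
invertible). -/
def leastSquares {p : ℕ} {ι : Type*} [Fintype ι] (X : Matrix ι (Fin p) ℝ) (y : ι → ℝ) :
    EuclideanSpace ℝ (Fin p) :=
  WithLp.toLp 2 ((Xᵀ * X)⁻¹ *ᵥ (Xᵀ *ᵥ y))

/-- The pooled treatment matrix: the observational rows followed by the interventional rows. -/
def pooledMatrix {p n m : ℕ} (sO : Fin n → EuclideanSpace ℝ (Fin p) × ℝ)
    (sI : Fin m → EuclideanSpace ℝ (Fin p) × ℝ) : Matrix (Fin n ⊕ Fin m) (Fin p) ℝ :=
  Matrix.fromRows (treatmentMatrix sO) (treatmentMatrix sI)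

/-- The pooled outcome vector. -/
def pooledVector {p n m : ℕ} (sO : Fin n → EuclideanSpace ℝ (Fin p) × ℝ)
    (sI : Fin m → EuclideanSpace ℝ (Fin p) × ℝ) : Fin n ⊕ Fin m → ℝ :=
  Sum.elim (outcomeVector sO) (outcomeVector sI)

/-- The purely interventional least-squares estimator. -/
def interventionalEstimator {p m : ℕ} (sI : Fin m → EuclideanSpace ℝ (Fin p) × ℝ) :
    EuclideanSpace ℝ (Fin p) :=
  leastSquares (treatmentMatrix sI) (outcomeVector sI)

/-- The pooled least-squares estimator. -/
def pooledEstimator {p n m : ℕ} (sO : Fin n → EuclideanSpace ℝ (Fin p) × ℝ)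
    (sI : Fin m → EuclideanSpace ℝ (Fin p) × ℝ) : EuclideanSpace ℝ (Fin p) :=
  leastSquares (pooledMatrix sO sI) (pooledVector sO sI)

/-- The pooling weight matrix `(X_Oᵀ X_O + X_Iᵀ X_I)⁻¹ X_Iᵀ X_I`. -/
def poolingWeight {p n m : ℕ} (sO : Fin n → EuclideanSpace ℝ (Fin p) × ℝ)
    (sI : Fin m → EuclideanSpace ℝ (Fin p) × ℝ) : Matrix (Fin p) (Fin p) ℝ :=
  ((treatmentMatrix sO)ᵀ * treatmentMatrix sO + (treatmentMatrix sI)ᵀ * treatmentMatrix sI)⁻¹ *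
    ((treatmentMatrix sI)ᵀ * treatmentMatrix sI)

/-- The mean squared error `E ‖a - α‖²` of a random vector `a`, as an element of `[0, ∞]`. -/
def meanSquaredError {Ω : Type*} [MeasurableSpace Ω] (P : Measure Ω) {p : ℕ}
    (a : Ω → EuclideanSpace ℝ (Fin p)) (α : EuclideanSpace ℝ (Fin p)) : ℝ≥0∞ :=
  ∫⁻ ω, ‖a ω - α‖ₑ ^ 2 ∂P

end

/-! The residual `y - xᵀα` equals `Zᵀγ + N_Y` in both models, so it has one centred law of finite
variance σ²; its independence from the treatment is available only under the intervention. Write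
G_O, G_I for the Gram matrices, S = G_O + G_I, and e_O, e_I for the residual vectors. The pooled
error is S⁻¹X_Oᵀe_O + S⁻¹X_Iᵀe_I. By Cauchy–Schwarz the first term has squared norm at most
tr(S⁻¹G_O S⁻¹)‖e_O‖² ≤ tr(G_I⁻¹)‖e_O‖², a product of independent factors. Integrating out e_I, the
second contributes σ² tr(S⁻¹G_I S⁻¹) ≤ σ² tr(G_I⁻¹). Hence the pooled MSE is at most 2(n+1) σ² E
tr(G_I⁻¹) (`meanSquaredError_pooled_le`).

Cutting the m interventional rows into blocks of size m₀, convexity of the inverse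
(`PosDef.dotProduct_inv_mulVec_le`) bounds E tr(G_I⁻¹) by 1/⌊m/m₀⌋ times its value at m₀
(`expectedPrecision_le`). Times σ², that value is exactly the interventional MSE at m₀
(`meanSquaredError_interventional`), which is finite. So the pooled MSE is O((n+1)/m).

For the weight, the strong law gives m⁻¹G_I → E[xxᵀ], positive definite by `secondMoment_posDef`,
while m⁻¹G_O → 0; continuity of inversion concludes. -/

open Matrix

/-! ### Trace inequalities for inverses of positive definite matrices -/

namespace Matrix

variable {κ : Type*} [Fintype κ]

theorem posSemidef_transpose_mul_self {ι : Type*} [Fintype ι] (X : Matrix ι κ ℝ) :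
    (Xᵀ * X).PosSemidef := by
  simpa using posSemidef_conjTranspose_mul_self X

/-- Cauchy–Schwarz in each row; the trace is the squared Frobenius norm. -/
theorem dotProduct_self_mulVec_le {ι : Type*} [Fintype ι] (A : Matrix κ ι ℝ) (e : ι → ℝ) :
    (A *ᵥ e) ⬝ᵥ (A *ᵥ e) ≤ (A * Aᵀ).trace * (e ⬝ᵥ e) := by
  rw [trace, Finset.sum_mul]
  refine Finset.sum_le_sum fun k _ => ?_
  have := Finset.sum_mul_sq_le_sq_mul_sq Finset.univ (A k) e
  simpa only [diag, mul_apply, transpose_apply, mulVec, dotProduct, ← pow_two] using this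

variable [DecidableEq κ]

/-- Expand the quadratic form of `A` at `u - A⁻¹ v`. This is the variational formula for `v ⬝ᵥ A⁻¹
*ᵥ v`, attained at `u = A⁻¹ v`. -/
theorem PosDef.two_mul_dotProduct_sub_le {A : Matrix κ κ ℝ} (hA : A.PosDef) (u v : κ → ℝ) :
    2 * (u ⬝ᵥ v) - u ⬝ᵥ A *ᵥ u ≤ v ⬝ᵥ A⁻¹ *ᵥ v := by
  have hdet : IsUnit A.det := (isUnit_iff_isUnit_det A).1 hA.isUnit
  have h := hA.posSemidef.dotProduct_mulVec_nonneg (u - A⁻¹ *ᵥ v)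
  have h1 : A *ᵥ (A⁻¹ *ᵥ v) = v := by
    rw [mulVec_mulVec, mul_nonsing_inv _ hdet, one_mulVec]
  have hT : Aᵀ = A := by simpa using hA.isHermitian.eq
  have h2 : (A⁻¹ *ᵥ v) ⬝ᵥ (A *ᵥ u) = u ⬝ᵥ v := by
    rw [dotProduct_mulVec, ← mulVec_transpose, hT, h1, dotProduct_comm]
  have h3 : (A⁻¹ *ᵥ v) ⬝ᵥ v = v ⬝ᵥ A⁻¹ *ᵥ v := dotProduct_comm _ _
  simp only [star_trivial, mulVec_sub, sub_dotProduct, dotProduct_sub, h1, h2, h3] at h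
  linarith

/-- A quantitative form of operator convexity and antitonicity of the inverse. -/
theorem PosDef.dotProduct_inv_mulVec_le {J : Type*} [Fintype J] [Nonempty J]
    {T : Matrix κ κ ℝ} {A : J → Matrix κ κ ℝ} (hT : T.PosDef) (hA : ∀ j, (A j).PosDef)
    (h : (T - ∑ j, A j).PosSemidef) (v : κ → ℝ) :
    v ⬝ᵥ T⁻¹ *ᵥ v ≤ ((Fintype.card J : ℝ) ^ 2)⁻¹ * ∑ j, v ⬝ᵥ (A j)⁻¹ *ᵥ v := by
  set u := T⁻¹ *ᵥ v with hu
  have hdet : IsUnit T.det := (isUnit_iff_isUnit_det T).1 hT.isUnit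
  have h1 : T *ᵥ u = v := by
    rw [hu, mulVec_mulVec, mul_nonsing_inv _ hdet, one_mulVec]
  set k : ℝ := (Fintype.card J : ℝ) with hk
  have hk0 : k ≠ 0 := by simp [hk]
  have h2 := h.dotProduct_mulVec_nonneg u
  simp only [star_trivial, sub_mulVec, dotProduct_sub, h1, sum_mulVec, dotProduct_sum] at h2
  -- The optimiser `u` for `T` is a test vector for every `A j`. Scaling `v` by `k⁻¹` makes the
  -- linear terms add up to `2 * (u ⬝ᵥ v)`, of which the quadratic terms take away at most `u ⬝ᵥ v`.
  have h3 : ∀ j, 2 * (u ⬝ᵥ (k⁻¹ • v)) - u ⬝ᵥ A j *ᵥ u ≤ (k ^ 2)⁻¹ * (v ⬝ᵥ (A j)⁻¹ *ᵥ v) := by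
    intro j
    refine ((hA j).two_mul_dotProduct_sub_le u (k⁻¹ • v)).trans_eq ?_
    simp only [mulVec_smul, dotProduct_smul, smul_dotProduct, smul_eq_mul]
    field_simp
  have h4 := Finset.sum_le_sum fun j (_ : j ∈ Finset.univ) => h3 j
  rw [← Finset.mul_sum, Finset.sum_sub_distrib, Finset.sum_const, Finset.card_univ, nsmul_eq_mul,
    ← hk, dotProduct_smul, smul_eq_mul] at h4
  have h5 : k * (2 * (k⁻¹ * (u ⬝ᵥ v))) = 2 * (u ⬝ᵥ v) := by field_simp
  rw [h5] at h4
  rw [dotProduct_comm v u]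
  linarith

theorem trace_eq_sum_dotProduct_single (A : Matrix κ κ ℝ) :
    A.trace = ∑ i, Pi.single i (1 : ℝ) ⬝ᵥ A *ᵥ Pi.single i 1 := by
  simp [trace]

theorem PosDef.trace_inv_le {J : Type*} [Fintype J] [Nonempty J]
    {T : Matrix κ κ ℝ} {A : J → Matrix κ κ ℝ} (hT : T.PosDef) (hA : ∀ j, (A j).PosDef)
    (h : (T - ∑ j, A j).PosSemidef) :
    T⁻¹.trace ≤ ((Fintype.card J : ℝ) ^ 2)⁻¹ * ∑ j, (A j)⁻¹.trace := by
  simp only [trace_eq_sum_dotProduct_single]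
  rw [Finset.sum_comm, Finset.mul_sum]
  exact Finset.sum_le_sum fun i _ => hT.dotProduct_inv_mulVec_le hA h _

/-- Conjugating `S - G` by `S⁻¹` preserves positivity. -/
theorem PosDef.trace_inv_mul_mul_inv_le {S G : Matrix κ κ ℝ} (hS : S.PosDef)
    (h : (S - G).PosSemidef) : (S⁻¹ * G * S⁻¹).trace ≤ S⁻¹.trace := by
  have hdet : IsUnit S.det := (isUnit_iff_isUnit_det S).1 hS.isUnit
  have h1 := (h.conjTranspose_mul_mul_same S⁻¹).trace_nonneg
  rw [hS.inv.isHermitian.eq, mul_sub, sub_mul, nonsing_inv_mul _ hdet, one_mul, trace_sub] at h1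
  linarith

theorem posDef_transpose_mul_self {ι : Type*} [Fintype ι] {X : Matrix ι κ ℝ}
    (h : IsUnit (Xᵀ * X).det) : (Xᵀ * X).PosDef :=
  (posSemidef_transpose_mul_self X).posDef_iff_isUnit.2 ((isUnit_iff_isUnit_det _).2 h)

theorem isUnit_det_of_posDef {A : Matrix κ κ ℝ} (h : A.PosDef) : IsUnit A.det :=
  (isUnit_iff_isUnit_det A).1 h.isUnit

theorem inv_mul_transpose_mul_self {ι : Type*} [Fintype ι] (S : Matrix κ κ ℝ)
    (hS : S.PosDef) (X : Matrix ι κ ℝ) :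
    (S⁻¹ * Xᵀ) * (S⁻¹ * Xᵀ)ᵀ = S⁻¹ * (Xᵀ * X) * S⁻¹ := by
  have : S⁻¹ᵀ = S⁻¹ := by simpa using hS.inv.isHermitian.eq
  rw [transpose_mul, transpose_transpose, this]
  simp only [Matrix.mul_assoc]

end Matrix

/-! ### Deterministic error bound for stacked least squares -/

variable {p : ℕ}

theorem leastSquares_sub {ι : Type*} [Fintype ι] (X : Matrix ι (Fin p) ℝ)
    (a : EuclideanSpace ℝ (Fin p)) (y : ι → ℝ) (h : IsUnit (Xᵀ * X).det) :
    leastSquares X y - a = WithLp.toLp 2 (((Xᵀ * X)⁻¹ * Xᵀ) *ᵥ (y - X *ᵥ a.ofLp)) := by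
  have : a = WithLp.toLp 2 a.ofLp := rfl
  conv_lhs => rw [this]
  rw [leastSquares, ← WithLp.toLp_sub]
  congr 1
  rw [mulVec_sub, mulVec_mulVec, mulVec_mulVec, Matrix.mul_assoc _ Xᵀ X, nonsing_inv_mul _ h,
    one_mulVec]

theorem enorm_toLp_sq (v : Fin p → ℝ) :
    ‖WithLp.toLp 2 v‖ₑ ^ 2 = ENNReal.ofReal (v ⬝ᵥ v) := by
  rw [← ofReal_norm, ← ENNReal.ofReal_pow (norm_nonneg _), EuclideanSpace.norm_sq_eq]
  simp [dotProduct, pow_two]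

theorem dotProduct_self_add_le {ι : Type*} [Fintype ι] (v w : ι → ℝ) :
    (v + w) ⬝ᵥ (v + w) ≤ 2 * (v ⬝ᵥ v) + 2 * (w ⬝ᵥ w) := by
  simp only [dotProduct, Finset.mul_sum, ← Finset.sum_add_distrib]
  refine Finset.sum_le_sum fun i _ => ?_
  simp only [Pi.add_apply]
  nlinarith [sq_nonneg (v i - w i)]

theorem fromRows_transpose_mul_self {ι ι' : Type*} [Fintype ι] [Fintype ι']
    (X : Matrix ι (Fin p) ℝ) (X' : Matrix ι' (Fin p) ℝ) :
    (fromRows X X')ᵀ * fromRows X X' = Xᵀ * X + X'ᵀ * X' := by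
  rw [transpose_fromRows, fromCols_mul_fromRows]

theorem posDef_pooled {ι ι' : Type*} [Fintype ι] [Fintype ι']
    (X : Matrix ι (Fin p) ℝ) {X' : Matrix ι' (Fin p) ℝ} (h : (X'ᵀ * X').PosDef) :
    ((fromRows X X')ᵀ * fromRows X X').PosDef := by
  rw [fromRows_transpose_mul_self]
  exact Matrix.PosDef.posSemidef_add (posSemidef_transpose_mul_self X) h

theorem trace_inv_pooled_le {ι ι' : Type*} [Fintype ι] [Fintype ι']
    (X : Matrix ι (Fin p) ℝ) {X' : Matrix ι' (Fin p) ℝ} (h : (X'ᵀ * X').PosDef) :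
    (Xᵀ * X + X'ᵀ * X')⁻¹.trace ≤ (X'ᵀ * X')⁻¹.trace := by
  have hS := posDef_pooled X h
  rw [fromRows_transpose_mul_self] at hS
  have := PosDef.trace_inv_le (J := Unit) (A := fun _ => X'ᵀ * X') hS (fun _ => h) (by
    simpa using posSemidef_transpose_mul_self X)
  simpa using this

/-- Adding a sample `X` decreases the variance due to the noise in `X'`. -/
theorem trace_pooled_le {ι ι' : Type*} [Fintype ι] [Fintype ι']
    (X : Matrix ι (Fin p) ℝ) {X' : Matrix ι' (Fin p) ℝ} (h : (X'ᵀ * X').PosDef) :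
    (((Xᵀ * X + X'ᵀ * X')⁻¹ * X'ᵀ) * ((Xᵀ * X + X'ᵀ * X')⁻¹ * X'ᵀ)ᵀ).trace ≤
      (X'ᵀ * X')⁻¹.trace := by
  have hS := posDef_pooled X h
  rw [fromRows_transpose_mul_self] at hS
  rw [inv_mul_transpose_mul_self _ hS]
  refine (hS.trace_inv_mul_mul_inv_le ?_).trans (trace_inv_pooled_le X h)
  rw [add_sub_cancel_right]
  exact posSemidef_transpose_mul_self X

/-- The bound is free of `X`, which may be correlated with its own residuals; in expectation it can
therefore be separated from them. -/
theorem trace_confounded_le {ι ι' : Type*} [Fintype ι] [Fintype ι']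
    (X : Matrix ι (Fin p) ℝ) {X' : Matrix ι' (Fin p) ℝ} (h : (X'ᵀ * X').PosDef) :
    (((Xᵀ * X + X'ᵀ * X')⁻¹ * Xᵀ) * ((Xᵀ * X + X'ᵀ * X')⁻¹ * Xᵀ)ᵀ).trace ≤
      (X'ᵀ * X')⁻¹.trace := by
  have hS := posDef_pooled X h
  rw [fromRows_transpose_mul_self] at hS
  rw [inv_mul_transpose_mul_self _ hS]
  refine (hS.trace_inv_mul_mul_inv_le ?_).trans (trace_inv_pooled_le X h)
  rw [add_sub_cancel_left]
  exact posSemidef_transpose_mul_self X'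

/-- The error of a pooled least-squares estimator: the confounded part is controlled by the
precision of the second sample alone, the other part is kept. -/
theorem leastSquares_fromRows_sub_le {ι ι' : Type*} [Fintype ι] [Fintype ι']
    (X : Matrix ι (Fin p) ℝ) (X' : Matrix ι' (Fin p) ℝ)
    (a : EuclideanSpace ℝ (Fin p)) (y : ι → ℝ) (y' : ι' → ℝ) (h : (X'ᵀ * X').PosDef) :
    ‖leastSquares (fromRows X X') (Sum.elim y y') - a‖ₑ ^ 2 ≤
      2 * (ENNReal.ofReal (X'ᵀ * X')⁻¹.trace *
        ENNReal.ofReal ((y - X *ᵥ a.ofLp) ⬝ᵥ (y - X *ᵥ a.ofLp))) +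
      2 * ENNReal.ofReal
        ((((Xᵀ * X + X'ᵀ * X')⁻¹ * X'ᵀ) *ᵥ (y' - X' *ᵥ a.ofLp)) ⬝ᵥ
          (((Xᵀ * X + X'ᵀ * X')⁻¹ * X'ᵀ) *ᵥ (y' - X' *ᵥ a.ofLp))) := by
  have hS := posDef_pooled X h
  rw [leastSquares_sub _ _ _ (isUnit_det_of_posDef hS), enorm_toLp_sq]
  rw [fromRows_transpose_mul_self] at hS ⊢
  set S := Xᵀ * X + X'ᵀ * X' with hSdef
  have h1 : (S⁻¹ * (fromRows X X')ᵀ) *ᵥ (Sum.elim y y' - fromRows X X' *ᵥ a.ofLp) =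
      (S⁻¹ * Xᵀ) *ᵥ (y - X *ᵥ a.ofLp) + (S⁻¹ * X'ᵀ) *ᵥ (y' - X' *ᵥ a.ofLp) := by
    have h2 : Sum.elim y y' - fromRows X X' *ᵥ a.ofLp =
        Sum.elim (y - X *ᵥ a.ofLp) (y' - X' *ᵥ a.ofLp) := by
      rw [fromRows_mulVec]
      ext i
      cases i <;> rfl
    rw [h2, ← mulVec_mulVec, transpose_fromRows, fromCols_mulVec_sumElim, mulVec_add,
      mulVec_mulVec, mulVec_mulVec]
  rw [h1]
  have hsub : ∀ v : Fin p → ℝ, 0 ≤ v ⬝ᵥ v := fun v => by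
    simpa using dotProduct_star_self_nonneg v
  have h2' : ∀ r : ℝ, 2 * ENNReal.ofReal r = ENNReal.ofReal (2 * r) := fun r => by
    rw [ENNReal.ofReal_mul zero_le_two]; simp
  have htr := trace_confounded_le X h
  have htr0 : 0 ≤ (X'ᵀ * X')⁻¹.trace := h.inv.posSemidef.trace_nonneg
  have he0 : 0 ≤ (y - X *ᵥ a.ofLp) ⬝ᵥ (y - X *ᵥ a.ofLp) := by
    simpa using dotProduct_star_self_nonneg (y - X *ᵥ a.ofLp)
  rw [← ENNReal.ofReal_mul htr0, h2', h2', ← ENNReal.ofReal_add (by positivity)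
      (mul_nonneg zero_le_two (hsub _))]
  refine ENNReal.ofReal_le_ofReal ((dotProduct_self_add_le _ _).trans ?_)
  gcongr
  -- Only the confounded term is relaxed by Cauchy–Schwarz, at the cost of a factor of order the
  -- number of its rows. The other is kept exact, so that its centred noise can be integrated
  -- without such a factor.
  exact (dotProduct_self_mulVec_le _ _).trans (mul_le_mul_of_nonneg_right htr he0)

/-! ### Measurability of determinants and inverses -/

theorem measurable_det_of_entries {β κ : Type*} [MeasurableSpace β] [Fintype κ] [DecidableEq κ]
    {S : β → Matrix κ κ ℝ} (hS : ∀ i j, Measurable fun b => S b i j) :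
    Measurable fun b => (S b).det := by
  simp only [det_apply]
  fun_prop

/-- Cramer's rule: the adjugate entries are determinants of row-updated matrices. -/
theorem measurable_inv_of_entries {β κ : Type*} [MeasurableSpace β] [Fintype κ] [DecidableEq κ]
    {S : β → Matrix κ κ ℝ} (hS : ∀ i j, Measurable fun b => S b i j) (i j : κ) :
    Measurable fun b => (S b)⁻¹ i j := by
  simp only [inv_def, Matrix.smul_apply, smul_eq_mul, Ring.inverse_eq_inv', adjugate_apply]
  refine (measurable_det_of_entries hS).inv.mul (measurable_det_of_entries fun k l => ?_)
  by_cases h : k = j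
  · subst h
    simp
  · simpa [updateRow_ne h] using hS k l

/-! ### Gram matrices and their block decomposition -/

/-- The matrix whose rows are the treatments `x_iᵀ`. -/
def design {n : ℕ} (x : Fin n → EuclideanSpace ℝ (Fin p)) : Matrix (Fin n) (Fin p) ℝ :=
  Matrix.of fun i j => x i j

/-- The Gram matrix of the first `n` treatments. -/
def gramMatrix (x : ℕ → EuclideanSpace ℝ (Fin p)) (n : ℕ) : Matrix (Fin p) (Fin p) ℝ :=
  (design fun i : Fin n => x i)ᵀ * design fun i : Fin n => x i

theorem gram_eq_sum (x : ℕ → EuclideanSpace ℝ (Fin p)) (n : ℕ) :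
    gramMatrix x n = ∑ i ∈ Finset.range n, vecMulVec (x i).ofLp (x i).ofLp := by
  ext j k
  simp [gramMatrix, design, mul_apply, Matrix.sum_apply, vecMulVec_apply, Finset.sum_range]

theorem gram_posSemidef (x : ℕ → EuclideanSpace ℝ (Fin p)) (n : ℕ) : (gramMatrix x n).PosSemidef :=
  posSemidef_transpose_mul_self _

theorem gram_add (x : ℕ → EuclideanSpace ℝ (Fin p)) (n r : ℕ) :
    gramMatrix x (n + r) = gramMatrix x n + gramMatrix (fun i => x (n + i)) r := by
  simp only [gram_eq_sum, Finset.sum_range_add]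

theorem gram_mul (x : ℕ → EuclideanSpace ℝ (Fin p)) (k n : ℕ) :
    gramMatrix x (k * n) = ∑ j : Fin k, gramMatrix (fun i => x (j * n + i)) n := by
  induction k with
  | zero => simp [gram_eq_sum]
  | succ k ih => rw [Nat.succ_mul, gram_add, ih, Fin.sum_univ_castSucc]; simp

theorem gram_posDef_of_le {x : ℕ → EuclideanSpace ℝ (Fin p)} {n m : ℕ} (hnm : n ≤ m)
    (h : (gramMatrix x n).PosDef) : (gramMatrix x m).PosDef := by
  obtain ⟨r, rfl⟩ := Nat.exists_eq_add_of_le hnm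
  rw [gram_add]
  exact h.add_posSemidef (gram_posSemidef _ _)

theorem trace_inv_gram_le {x : ℕ → EuclideanSpace ℝ (Fin p)} {n m : ℕ} (hn : 0 < n) (hnm : n ≤ m)
    (h : ∀ j : Fin (m / n), (gramMatrix (fun i => x (j * n + i)) n).PosDef) :
    (gramMatrix x m)⁻¹.trace ≤
      (((m / n : ℕ) : ℝ) ^ 2)⁻¹ * ∑ j : Fin (m / n), (gramMatrix (fun i => x (j * n + i)) n)⁻¹.trace := by
  have hk : 0 < m / n := Nat.div_pos hnm hn
  have : Nonempty (Fin (m / n)) := ⟨⟨0, hk⟩⟩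
  have h0 : (gramMatrix x n).PosDef := by simpa using h ⟨0, hk⟩
  have := PosDef.trace_inv_le (T := gramMatrix x m) (gram_posDef_of_le hnm h0) h (by
    -- The `m % n` rows outside the full blocks only add a positive semidefinite matrix.
    rw [← gram_mul]
    conv in gramMatrix x m => rw [← Nat.div_add_mod' m n]
    rw [gram_add, add_sub_cancel_left]
    exact gram_posSemidef _ _)
  simpa using this

theorem measurable_design_gram {n : ℕ} (j k : Fin p) :
    Measurable fun x : Fin n → EuclideanSpace ℝ (Fin p) => ((design x)ᵀ * design x) j k := by
  simp only [mul_apply, transpose_apply, design, of_apply]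
  fun_prop

theorem measurable_isUnit_det_design {n : ℕ} :
    Measurable fun x : Fin n → EuclideanSpace ℝ (Fin p) =>
      IsUnit ((design x)ᵀ * design x).det := by
  simp only [isUnit_iff_ne_zero]
  exact measurableSet_setOfPred.1 (measurableSet_eq_fun
    (measurable_det_of_entries measurable_design_gram) measurable_const).compl

theorem measurable_trace_inv_design {n : ℕ} :
    Measurable fun x : Fin n → EuclideanSpace ℝ (Fin p) =>
      ENNReal.ofReal ((design x)ᵀ * design x)⁻¹.trace := by
  refine ENNReal.measurable_ofReal.comp ?_
  simp only [trace, diag]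
  exact Finset.measurable_sum _ fun i _ => measurable_inv_of_entries measurable_design_gram i i

/-- The expected trace of the inverse Gram matrix of `n` independent treatments of law `Q`. -/
noncomputable def expectedPrecision (Q : Measure (EuclideanSpace ℝ (Fin p))) (n : ℕ) : ℝ≥0∞ :=
  ∫⁻ x : Fin n → EuclideanSpace ℝ (Fin p),
    ENNReal.ofReal ((design x)ᵀ * design x)⁻¹.trace ∂(Measure.pi fun _ => Q)

/-! ### Gram matrices of independent identically distributed treatments -/

section Sequence

variable {Q : Measure (EuclideanSpace ℝ (Fin p))}
  {Ω : Type*} [MeasurableSpace Ω] {P : Measure Ω}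
  {x : ℕ → Ω → EuclideanSpace ℝ (Fin p)}

theorem hasLaw_pi_of_injective {Ω : Type*} [MeasurableSpace Ω] {P : Measure Ω} {𝓧 : Type*}
    [MeasurableSpace 𝓧] {μ : Measure 𝓧} {x : ℕ → Ω → 𝓧} (hx : ∀ i, HasLaw (x i) μ P) (hind : iIndepFun x P)
    {n : ℕ} {f : Fin n → ℕ} (hf : f.Injective) :
    HasLaw (fun ω i => x (f i) ω) (Measure.pi fun _ : Fin n => μ) P :=
  (hind.precomp hf).hasLaw_pi fun i => hx (f i)

theorem lintegral_trace_inv_gram (hx : ∀ i, HasLaw (x i) Q P) (hind : iIndepFun x P) (n l : ℕ) :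
    ∫⁻ ω, ENNReal.ofReal (gramMatrix (fun i => x (l + i) ω) n)⁻¹.trace ∂P = expectedPrecision Q n :=
  (hasLaw_pi_of_injective hx hind (f := fun i : Fin n => l + (i : ℕ))
    (fun i j h => by simpa [Fin.ext_iff] using h)).lintegral_comp
      measurable_trace_inv_design.aemeasurable

/-- Every block of length `n` has the same joint law as the first one. -/
theorem ae_gram_posDef (hx : ∀ i, HasLaw (x i) Q P) (hind : iIndepFun x P) {n : ℕ}
    (h : ∀ᵐ ω ∂P, IsUnit (gramMatrix (fun i => x i ω) n).det) (l : ℕ) :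
    ∀ᵐ ω ∂P, (gramMatrix (fun i => x (l + i) ω) n).PosDef := by
  have hl : ∀ l, HasLaw (fun ω (i : Fin n) => x (l + i) ω) (Measure.pi fun _ : Fin n => Q) P :=
    fun l => hasLaw_pi_of_injective hx hind (f := fun i : Fin n => l + (i : ℕ))
      (fun i j h => by simpa [Fin.ext_iff] using h)
  have h0 : ∀ᵐ y ∂(Measure.pi fun _ : Fin n => Q), IsUnit ((design y)ᵀ * design y).det := by
    refine ((hl 0).ae_iff measurable_isUnit_det_design).1 ?_
    simpa only [gramMatrix, zero_add] using h
  filter_upwards [((hl l).ae_iff measurable_isUnit_det_design).2 h0] with ω hω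
  exact posDef_transpose_mul_self hω

/-- There are `m / n` blocks of equal expectation, weighted by `(m / n)⁻²`. -/
theorem expectedPrecision_le (hx : ∀ i, HasLaw (x i) Q P) (hind : iIndepFun x P) {n m : ℕ}
    (h : ∀ᵐ ω ∂P, IsUnit (gramMatrix (fun i => x i ω) n).det) (hn : 0 < n) (hnm : n ≤ m) :
    expectedPrecision Q m ≤ ENNReal.ofReal ((m / n : ℕ) : ℝ)⁻¹ * expectedPrecision Q n := by
  set k := m / n with hkdef
  have hk : 0 < k := Nat.div_pos hnm hn
  have hx' : ∀ i, AEMeasurable (x i) P := fun i => (hx i).aemeasurable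
  have hae : ∀ᵐ ω ∂P, ∀ j : Fin k, (gramMatrix (fun i => x (j * n + i) ω) n).PosDef :=
    ae_all_iff.2 fun j => ae_gram_posDef hx hind h _
  have hk2 : (0 : ℝ) ≤ ((k : ℝ) ^ 2)⁻¹ := by positivity
  rw [← lintegral_trace_inv_gram hx hind m 0]
  calc ∫⁻ ω, ENNReal.ofReal (gramMatrix (fun i => x (0 + i) ω) m)⁻¹.trace ∂P
      ≤ ∫⁻ ω, ENNReal.ofReal ((k : ℝ) ^ 2)⁻¹ *
          ∑ j : Fin k, ENNReal.ofReal (gramMatrix (fun i => x (j * n + i) ω) n)⁻¹.trace ∂P := by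
        refine lintegral_mono_ae ?_
        filter_upwards [hae] with ω hω
        rw [← ENNReal.ofReal_sum_of_nonneg fun j _ => (hω j).inv.posSemidef.trace_nonneg,
          ← ENNReal.ofReal_mul hk2]
        refine ENNReal.ofReal_le_ofReal ?_
        simp only [zero_add]
        exact trace_inv_gram_le (x := fun i => x i ω) hn hnm hω
    _ = ENNReal.ofReal ((k : ℝ) ^ 2)⁻¹ * ∑ j : Fin k, expectedPrecision Q n := by
        rw [lintegral_const_mul' _ _ ENNReal.ofReal_ne_top, lintegral_finsetSum']
        · simp only [lintegral_trace_inv_gram hx hind]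
        · intro j _
          exact measurable_trace_inv_design.comp_aemeasurable
            (aemeasurable_pi_lambda (fun ω (i : Fin n) => x (j * n + i) ω) fun i => hx' _)
    _ = ENNReal.ofReal (k : ℝ)⁻¹ * expectedPrecision Q n := by
        rw [Finset.sum_const, Finset.card_univ, Fintype.card_fin, nsmul_eq_mul, ← mul_assoc]
        congr 1
        rw [← ENNReal.ofReal_natCast, ← ENNReal.ofReal_mul hk2]
        congr 1
        field_simp

/-- The strong law of large numbers for Gram matrices. -/
theorem ae_tendsto_gram (hx : ∀ i, HasLaw (x i) Q P) (hind : iIndepFun x P)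
    (hQ : ∀ j, MemLp (fun y : EuclideanSpace ℝ (Fin p) => y j) 2 Q) :
    ∀ᵐ ω ∂P, Tendsto (fun n : ℕ => (n : ℝ)⁻¹ • gramMatrix (fun i => x i ω) n) atTop
      (𝓝 (Matrix.of fun j k => ∫ y, y j * y k ∂Q)) := by
  have hent : ∀ j k : Fin p, ∀ᵐ ω ∂P,
      Tendsto (fun n : ℕ => (∑ i ∈ Finset.range n, x i ω j * x i ω k) / n) atTop
        (𝓝 (∫ y, y j * y k ∂Q)) := by
    intro j k
    have hg : Measurable fun y : EuclideanSpace ℝ (Fin p) => y j * y k := by fun_prop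
    have hint : Integrable (fun y : EuclideanSpace ℝ (Fin p) => y j * y k) Q :=
      (hQ j).integrable_mul (hQ k)
    have hint' : Integrable (fun ω => x 0 ω j * x 0 ω k) P :=
      (integrable_map_measure hg.aestronglyMeasurable (hx 0).aemeasurable).1
        ((hx 0).map_eq ▸ hint)
    have := strong_law_ae_real (μ := P) (fun i ω => x i ω j * x i ω k) hint'
      (fun i l hil => (hind.indepFun hil).comp hg hg)
      (fun i => ((hx i).identDistrib (hx 0)).comp hg)
    have h2 : P[fun ω => x 0 ω j * x 0 ω k] = ∫ y, y j * y k ∂Q :=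
      (hx 0).integral_comp hg.aestronglyMeasurable
    rwa [h2] at this
  have hall := ae_all_iff.2 fun j => ae_all_iff.2 fun k => hent j k
  filter_upwards [hall] with ω hω
  refine tendsto_pi_nhds.2 fun j => tendsto_pi_nhds.2 fun k => ?_
  refine (hω j k).congr fun n => ?_
  simp [gram_eq_sum, Matrix.sum_apply, vecMulVec_apply, div_eq_inv_mul]

/-- A null vector `v` of the second-moment matrix is almost surely orthogonal to every treatment,
hence lies in the kernel of the almost surely invertible Gram matrix. -/
theorem secondMoment_posDef [IsProbabilityMeasure P] (hx : ∀ i, HasLaw (x i) Q P)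
    (hQ : ∀ j, MemLp (fun y : EuclideanSpace ℝ (Fin p) => y j) 2 Q) {n : ℕ}
    (h : ∀ᵐ ω ∂P, IsUnit (gramMatrix (fun i => x i ω) n).det) :
    (Matrix.of fun j k : Fin p => ∫ y, y j * y k ∂Q).PosDef := by
  refine PosDef.of_dotProduct_mulVec_pos ?_ fun v hv => ?_
  · ext j k
    simp [mul_comm]
  have hint : ∀ j k, Integrable (fun y : EuclideanSpace ℝ (Fin p) => y j * y k) Q :=
    fun j k => (hQ j).integrable_mul (hQ k)
  have hsq : Integrable (fun y : EuclideanSpace ℝ (Fin p) => (v ⬝ᵥ y.ofLp) ^ 2) Q := by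
    have : MemLp (fun y : EuclideanSpace ℝ (Fin p) => v ⬝ᵥ y.ofLp) 2 Q := by
      simp only [dotProduct]
      exact memLp_finsetSum _ fun j _ => (hQ j).const_mul (v j)
    exact this.integrable_sq
  have heq : star v ⬝ᵥ (Matrix.of fun j k : Fin p => ∫ y, y j * y k ∂Q) *ᵥ v =
      ∫ y, (v ⬝ᵥ y.ofLp) ^ 2 ∂Q := by
    have : ∀ y : EuclideanSpace ℝ (Fin p),
        (v ⬝ᵥ y.ofLp) ^ 2 = ∑ j, ∑ k, v j * v k * (y j * y k) := by
      intro y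
      simp only [dotProduct, pow_two, Finset.sum_mul_sum]
      refine Finset.sum_congr rfl fun j _ => Finset.sum_congr rfl fun k _ => by ring
    simp only [this]
    rw [integral_finsetSum _ fun j _ => integrable_finsetSum _ fun k _ =>
      (hint j k).const_mul _]
    simp only [star_trivial, dotProduct, mulVec, of_apply, Finset.mul_sum]
    refine Finset.sum_congr rfl fun j _ => ?_
    rw [integral_finsetSum _ fun k _ => (hint j k).const_mul _]
    refine Finset.sum_congr rfl fun k _ => ?_
    rw [integral_const_mul]
    ring
  rw [heq]
  refine lt_of_le_of_ne (integral_nonneg fun y => sq_nonneg _) fun h0 => hv ?_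
  have h1 := (integral_eq_zero_iff_of_nonneg (fun y => sq_nonneg _) hsq).1 h0.symm
  have hm : Measurable fun y : EuclideanSpace ℝ (Fin p) => v ⬝ᵥ y.ofLp = 0 := by
    have : Measurable fun y : EuclideanSpace ℝ (Fin p) => v ⬝ᵥ y.ofLp := by
      simp only [dotProduct]; fun_prop
    exact measurableSet_setOfPred.1 (measurableSet_eq_fun this measurable_const)
  have h2 : ∀ᵐ ω ∂P, ∀ i, v ⬝ᵥ (x i ω).ofLp = 0 := ae_all_iff.2 fun i =>
    ((hx i).ae_iff hm).2 (h1.mono fun y hy => by simpa using hy)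
  obtain ⟨ω, hω, hu⟩ := (h2.and h).exists
  have hz : gramMatrix (fun i => x i ω) n *ᵥ v = 0 := by
    rw [gram_eq_sum, sum_mulVec]
    refine Finset.sum_eq_zero fun i _ => ?_
    rw [vecMulVec_mulVec, dotProduct_comm, hω i]
    simp
  exact eq_zero_of_mulVec_eq_zero hu.ne_zero hz

end Sequence

/-! ### Limit of the pooling weight -/

theorem inv_smul_of_ne_zero {κ : Type*} [Fintype κ] [DecidableEq κ] {c : ℝ} (hc : c ≠ 0)
    (S : Matrix κ κ ℝ) : (c • S)⁻¹ = c⁻¹ • S⁻¹ := by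
  by_cases h : IsUnit S.det
  · exact inv_smul' S (Units.mk0 c hc) h
  -- Both inverses are then the default value `0`.
  · have h' : ¬ IsUnit (c • S).det := by
      rw [isUnit_iff_ne_zero, not_not] at h ⊢
      simp [h]
    rw [nonsing_inv_apply_not_isUnit _ h, nonsing_inv_apply_not_isUnit _ h', smul_zero]

/-- A sample of negligible relative size has asymptotically negligible weight. -/
theorem tendsto_inv_mul_of_negligible {κ : Type*} [Fintype κ] [DecidableEq κ]
    {G H : ℕ → Matrix κ κ ℝ} {A C : Matrix κ κ ℝ} (hA : IsUnit A.det)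
    (hG : Tendsto (fun m : ℕ => (m : ℝ)⁻¹ • G m) atTop (𝓝 A))
    (hH : Tendsto (fun m : ℕ => (m : ℝ)⁻¹ • H m) atTop (𝓝 C)) (hH0 : H 0 = 0)
    {n : ℕ → ℕ} (hn : Tendsto (fun m : ℕ => (n m : ℝ) / (m : ℝ)) atTop (𝓝 0)) :
    Tendsto (fun m => (H (n m) + G m)⁻¹ * G m) atTop (𝓝 1) := by
  have hsmall : Tendsto (fun m : ℕ => (m : ℝ)⁻¹ • H (n m)) atTop (𝓝 0) := by
    refine tendsto_pi_nhds.2 fun i => tendsto_pi_nhds.2 fun j => ?_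
    -- `n m` need not tend to infinity, so only boundedness of the normalised sequence is used.
    obtain ⟨c, hc⟩ := (Metric.isBounded_range_of_tendsto _
      (tendsto_pi_nhds.1 (tendsto_pi_nhds.1 hH i) j)).exists_norm_le
    refine squeeze_zero_norm (a := fun m : ℕ => (n m : ℝ) / m * c) (fun m => ?_)
      (by simpa using hn.mul_const c)
    rcases Nat.eq_zero_or_pos (n m) with h0 | h0
    · simp [h0, hH0]
    · have h1 := hc _ ⟨n m, rfl⟩
      have h2 : ((m : ℝ)⁻¹ • H (n m)) i j = (n m : ℝ) / m * ((n m : ℝ)⁻¹ • H (n m)) i j := by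
        simp only [Matrix.smul_apply, smul_eq_mul]
        field_simp
      rw [h2, norm_mul, Real.norm_of_nonneg (by positivity)]
      gcongr
  have hS : Tendsto (fun m : ℕ => (m : ℝ)⁻¹ • (H (n m) + G m)) atTop (𝓝 A) := by
    simpa using hsmall.add hG
  have hdet : ContinuousAt Ring.inverse A.det := NormedRing.inverse_continuousAt hA.unit
  have hinv : Tendsto (fun m : ℕ => ((m : ℝ)⁻¹ • (H (n m) + G m))⁻¹) atTop (𝓝 A⁻¹) :=
    (continuousAt_matrix_inv A hdet).tendsto.comp hS
  have := hinv.mul hG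
  rw [nonsing_inv_mul _ hA] at this
  refine this.congr' ?_
  filter_upwards [eventually_gt_atTop 0] with m hm
  have hm' : (m : ℝ)⁻¹ ≠ 0 := by positivity
  rw [inv_smul_of_ne_zero hm', smul_mul_smul_comm, inv_mul_cancel₀ hm', one_smul]

/-! ### Quadratic forms in independent centred noise -/

theorem measurable_quadratic_of_entries {β : Type*} [MeasurableSpace β] {m : ℕ}
    {B : β → Matrix (Fin p) (Fin m) ℝ} {e : β → Fin m → ℝ}
    (hB : ∀ i j, Measurable fun b => B b i j) (he : ∀ j, Measurable fun b => e b j) :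
    Measurable fun b => ENNReal.ofReal ((B b *ᵥ e b) ⬝ᵥ (B b *ᵥ e b)) := by
  refine ENNReal.measurable_ofReal.comp ?_
  simp only [dotProduct, mulVec]
  fun_prop

theorem measurable_inv_mul_transpose_of_entries {β : Type*} [MeasurableSpace β] {m : ℕ}
    {S : β → Matrix (Fin p) (Fin p) ℝ} {X : β → Matrix (Fin m) (Fin p) ℝ}
    (hS : ∀ i j, Measurable fun b => S b i j) (hX : ∀ i j, Measurable fun b => X b i j)
    (i : Fin p) (j : Fin m) : Measurable fun b => ((S b)⁻¹ * (X b)ᵀ) i j := by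
  have h (k : Fin p) := measurable_inv_of_entries hS i k
  simp only [Matrix.mul_apply, transpose_apply]
  exact Finset.measurable_sum _ fun k _ => (h k).mul (hX j k)

theorem measurable_design {β : Type*} [MeasurableSpace β] {m : ℕ}
    {x : β → Fin m → EuclideanSpace ℝ (Fin p)} (hx : Measurable x) (i : Fin m) (j : Fin p) :
    Measurable fun b => design (x b) i j := by
  simp only [design, of_apply]
  fun_prop

/-- Each coordinate of `A *ᵥ e` is a sum of independent centred variables, so its second moment is
the sum of their variances. -/
theorem lintegral_quadratic_pi {ν : Measure ℝ} [IsProbabilityMeasure ν] (hν : MemLp id 2 ν)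
    (h0 : ∫ e, e ∂ν = 0) {m : ℕ} (A : Matrix (Fin p) (Fin m) ℝ) :
    ∫⁻ e, ENNReal.ofReal ((A *ᵥ e) ⬝ᵥ (A *ᵥ e)) ∂(Measure.pi fun _ : Fin m => ν) =
      ENNReal.ofReal (∫ e, e ^ 2 ∂ν) * ENNReal.ofReal (A * Aᵀ).trace := by
  have hX : ∀ k i, MemLp (fun e : ℝ => A k i * e) 2 ν := fun k i => hν.const_mul _
  have hrow : ∀ k, ∫⁻ e, ENNReal.ofReal ((A *ᵥ e) k * (A *ᵥ e) k)
        ∂(Measure.pi fun _ : Fin m => ν) =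
      ENNReal.ofReal (∫ e, e ^ 2 ∂ν) * ENNReal.ofReal (∑ i, A k i * A k i) := by
    intro k
    have hmem : ∀ i, MemLp (fun e : Fin m → ℝ => A k i * e i) 2 (Measure.pi fun _ : Fin m => ν) :=
      fun i => (hX k i).comp_measurePreserving (measurePreserving_eval _ i)
    have hsum : (∑ i, fun e : Fin m → ℝ => A k i * e i) = fun e => (A *ᵥ e) k := by
      ext e
      simp [mulVec, dotProduct]
    have hmem' : MemLp (fun e : Fin m → ℝ => (A *ᵥ e) k) 2 (Measure.pi fun _ : Fin m => ν) := by
      rw [← hsum]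
      exact memLp_finsetSum' _ fun i _ => hmem i
    have hmean : ∫ e, (A *ᵥ e) k ∂(Measure.pi fun _ : Fin m => ν) = 0 := by
      simp only [mulVec, dotProduct]
      rw [integral_finsetSum _ fun i _ => (hmem i).integrable one_le_two]
      refine Finset.sum_eq_zero fun i _ => ?_
      rw [integral_const_mul, integral_comp_eval (μ := fun _ : Fin m => ν) (i := i)
        (f := fun x : ℝ => x) aestronglyMeasurable_id, h0, mul_zero]
    have hvar := variance_sum_pi (μ := fun _ : Fin m => ν) (X := fun i e => A k i * e) (hX k)
    rw [hsum, variance_of_integral_eq_zero hmem'.aestronglyMeasurable.aemeasurable hmean] at hvar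
    have hvar1 : ∀ i, Var[fun e => A k i * e; ν] = A k i ^ 2 * ∫ e, e ^ 2 ∂ν := by
      intro i
      rw [variance_const_mul, variance_of_integral_eq_zero aemeasurable_id' h0]
    simp only [hvar1, ← Finset.sum_mul] at hvar
    simp only [← pow_two]
    rw [← ofReal_integral_eq_lintegral_ofReal hmem'.integrable_sq
      (Eventually.of_forall fun e => sq_nonneg _), hvar, mul_comm,
      ENNReal.ofReal_mul (integral_nonneg fun e => sq_nonneg e)]
  have hpt : ∀ e : Fin m → ℝ, ENNReal.ofReal ((A *ᵥ e) ⬝ᵥ (A *ᵥ e)) =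
      ∑ k, ENNReal.ofReal ((A *ᵥ e) k * (A *ᵥ e) k) := fun e =>
    ENNReal.ofReal_sum_of_nonneg fun k _ => mul_self_nonneg _
  simp only [hpt]
  rw [lintegral_finsetSum _ fun k _ => by
    simp only [mulVec, dotProduct]
    fun_prop]
  simp only [hrow, ← Finset.mul_sum]
  congr 1
  rw [trace, ENNReal.ofReal_sum_of_nonneg fun k _ => ?_]
  · rfl
  · simp only [diag, mul_apply, transpose_apply]
    exact Finset.sum_nonneg fun i _ => mul_self_nonneg _

/-- The part of the outcome that is not explained by the linear effect `a` of the treatment. -/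
def outcomeResidual (a : EuclideanSpace ℝ (Fin p)) (s : EuclideanSpace ℝ (Fin p) × ℝ) : ℝ :=
  s.2 - s.1.ofLp ⬝ᵥ a.ofLp

theorem measurable_outcomeResidual (a : EuclideanSpace ℝ (Fin p)) : Measurable (outcomeResidual a) := by
  unfold outcomeResidual
  simp only [dotProduct]
  fun_prop

theorem outcomeVector_sub {n : ℕ} (a : EuclideanSpace ℝ (Fin p))
    (s : Fin n → EuclideanSpace ℝ (Fin p) × ℝ) :
    outcomeVector s - treatmentMatrix s *ᵥ a.ofLp = fun i => outcomeResidual a (s i) := rfl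

/-! ### Mean squared errors of the two estimators -/

section Estimation

variable {a : EuclideanSpace ℝ (Fin p)} {μO μI : Measure (EuclideanSpace ℝ (Fin p) × ℝ)}
  {Q : Measure (EuclideanSpace ℝ (Fin p))} {ν : Measure ℝ}
  [IsProbabilityMeasure Q] [IsProbabilityMeasure ν]
  {Ω : Type*} [MeasurableSpace Ω] {P : Measure Ω} 
  {sO sI : ℕ → Ω → EuclideanSpace ℝ (Fin p) × ℝ}

theorem measurePreserving_split [IsProbabilityMeasure μI]
    (h : MeasurePreserving (fun s => (s.1, outcomeResidual a s)) μI (Q.prod ν)) (m : ℕ) :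
    MeasurePreserving
      (fun s : Fin m → EuclideanSpace ℝ (Fin p) × ℝ =>
        ((fun i => (s i).1, fun i => outcomeResidual a (s i)) :
          (Fin m → EuclideanSpace ℝ (Fin p)) × (Fin m → ℝ)))
      (Measure.pi fun _ => μI) ((Measure.pi fun _ => Q).prod (Measure.pi fun _ => ν)) :=
  (measurePreserving_arrowProdEquivProdArrow _ _ (Fin m) (fun _ => Q) (fun _ => ν)).comp
    (measurePreserving_pi (fun _ => μI) (fun _ => Q.prod ν) fun _ => h)

theorem hasLaw_pair [IsProbabilityMeasure μO] [IsProbabilityMeasure μI]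
    (hO : ∀ i, HasLaw (sO i) μO P) (hI : ∀ i, HasLaw (sI i) μI P)
    (hind : iIndepFun (Sum.elim sO sI : ℕ ⊕ ℕ → Ω → EuclideanSpace ℝ (Fin p) × ℝ) P) (n m : ℕ) :
    HasLaw (fun ω => ((fun i => sO i ω, fun i => sI i ω) :
      (Fin n → EuclideanSpace ℝ (Fin p) × ℝ) × (Fin m → EuclideanSpace ℝ (Fin p) × ℝ)))
      ((Measure.pi fun _ => μO).prod (Measure.pi fun _ => μI)) P := by
  have hinj : Function.Injective
      (Sum.map (fun i : Fin n => (i : ℕ)) (fun i : Fin m => (i : ℕ))) :=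
    Fin.val_injective.sumMap Fin.val_injective
  have hlaw := (hind.precomp hinj).hasLaw_pi
    (μ := Sum.elim (fun _ => μO) (fun _ => μI)) (by rintro (i | i) <;> simp [hO, hI])
  have hsf : ∀ i, SigmaFinite
      ((Sum.elim (fun _ => μO) (fun _ => μI) : Fin n ⊕ Fin m → Measure _) i) := by
    rintro (i | i) <;> simp only [Sum.elim_inl, Sum.elim_inr] <;> infer_instance
  have hmp := (measurePreserving_sumPiEquivProdPi_symm
    (X := fun _ : Fin n ⊕ Fin m => EuclideanSpace ℝ (Fin p) × ℝ)
    (Sum.elim (fun _ => μO) (fun _ => μI))).symm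
  exact hmp.comp_hasLaw hlaw

/-- The interventional noise becomes a separate product factor, so Fubini can integrate it with both
designs frozen. The observational residuals stay tied to their treatments. -/
theorem hasLaw_triple [IsProbabilityMeasure μO] [IsProbabilityMeasure μI]
    (hO : ∀ i, HasLaw (sO i) μO P) (hI : ∀ i, HasLaw (sI i) μI P)
    (hind : iIndepFun (Sum.elim sO sI : ℕ ⊕ ℕ → Ω → EuclideanSpace ℝ (Fin p) × ℝ) P)
    (h : MeasurePreserving (fun s => (s.1, outcomeResidual a s)) μI (Q.prod ν)) (n m : ℕ) :
    HasLaw (fun ω => ((fun i => sO i ω, fun i => (sI i ω).1, fun i => outcomeResidual a (sI i ω)) :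
      (Fin n → EuclideanSpace ℝ (Fin p) × ℝ) ×
        (Fin m → EuclideanSpace ℝ (Fin p)) × (Fin m → ℝ)))
      ((Measure.pi fun _ => μO).prod ((Measure.pi fun _ => Q).prod (Measure.pi fun _ => ν))) P :=
  ((MeasurePreserving.id _).prod (measurePreserving_split h m)).comp_hasLaw
    (hasLaw_pair hO hI hind n m)

/-- Under exogeneity, the mean squared error of least squares is the noise variance times the
expected trace of the inverse Gram matrix. -/
theorem meanSquaredError_interventional [IsProbabilityMeasure μI]
    (hI : ∀ i, HasLaw (sI i) μI P) (hind : iIndepFun sI P)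
    (h : MeasurePreserving (fun s => (s.1, outcomeResidual a s)) μI (Q.prod ν))
    (hν : MemLp id 2 ν) (h0 : ∫ e, e ∂ν = 0) {m : ℕ}
    (hinv : ∀ᵐ ω ∂P, IsUnit (gramMatrix (fun i => (sI i ω).1) m).det) :
    meanSquaredError P (fun ω => interventionalEstimator fun i : Fin m => sI i ω) a =
      ENNReal.ofReal (∫ e, e ^ 2 ∂ν) * expectedPrecision Q m := by
  have hlaw : HasLaw (fun ω => ((fun i => (sI i ω).1, fun i => outcomeResidual a (sI i ω)) :
        (Fin m → EuclideanSpace ℝ (Fin p)) × (Fin m → ℝ)))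
      ((Measure.pi fun _ => Q).prod (Measure.pi fun _ => ν)) P :=
    (measurePreserving_split h m).comp_hasLaw
      (hasLaw_pi_of_injective hI hind (f := fun i : Fin m => (i : ℕ)) Fin.val_injective)
  have hlawx : HasLaw (fun ω => (fun i => (sI i ω).1 : Fin m → EuclideanSpace ℝ (Fin p)))
      (Measure.pi fun _ => Q) P := measurePreserving_fst.comp_hasLaw hlaw
  set F : (Fin m → EuclideanSpace ℝ (Fin p)) × (Fin m → ℝ) → ℝ≥0∞ := fun z =>
    ENNReal.ofReal (((((design z.1)ᵀ * design z.1)⁻¹ * (design z.1)ᵀ) *ᵥ z.2) ⬝ᵥ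
      ((((design z.1)ᵀ * design z.1)⁻¹ * (design z.1)ᵀ) *ᵥ z.2)) with hF
  have hFm : Measurable F := by
    refine measurable_quadratic_of_entries (measurable_inv_mul_transpose_of_entries
      (fun i j => (measurable_design_gram i j).comp measurable_fst)
      (measurable_design measurable_fst)) (fun j => by fun_prop)
  have hmse : meanSquaredError P (fun ω => interventionalEstimator fun i : Fin m => sI i ω) a =
      ∫⁻ ω, F (fun i => (sI i ω).1, fun i => outcomeResidual a (sI i ω)) ∂P := by
    refine lintegral_congr_ae ?_
    filter_upwards [hinv] with ω hω
    change IsUnit ((treatmentMatrix fun i : Fin m => sI i ω)ᵀ *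
      treatmentMatrix fun i : Fin m => sI i ω).det at hω
    rw [interventionalEstimator, leastSquares_sub _ _ _ hω, enorm_toLp_sq, outcomeVector_sub]
    rfl
  rw [hmse, hlaw.lintegral_comp hFm.aemeasurable, lintegral_prod _ hFm.aemeasurable]
  simp only [hF, lintegral_quadratic_pi hν h0]
  rw [lintegral_const_mul' _ _ ENNReal.ofReal_ne_top, expectedPrecision]
  congr 1
  refine lintegral_congr_ae ?_
  have hm : Measurable fun y : Fin m → EuclideanSpace ℝ (Fin p) =>
      IsUnit ((design y)ᵀ * design y).det := measurable_isUnit_det_design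
  filter_upwards [(hlawx.ae_iff hm).1 hinv] with x hx
  have hpd := posDef_transpose_mul_self hx
  rw [inv_mul_transpose_mul_self _ hpd, nonsing_inv_mul _ hx, one_mul]

/-- In the factor `n + 1`, the `n` comes from the `n` observational residuals, each of second moment
σ², and the `1` from the interventional noise; the `2` is from splitting the square. -/
theorem meanSquaredError_pooled_le [IsProbabilityMeasure μO] [IsProbabilityMeasure μI]
    (hO : ∀ i, HasLaw (sO i) μO P) (hI : ∀ i, HasLaw (sI i) μI P)
    (hind : iIndepFun (Sum.elim sO sI : ℕ ⊕ ℕ → Ω → EuclideanSpace ℝ (Fin p) × ℝ) P)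
    (hresO : MeasurePreserving (outcomeResidual a) μO ν)
    (hresI : MeasurePreserving (fun s => (s.1, outcomeResidual a s)) μI (Q.prod ν))
    (hν : MemLp id 2 ν) (h0 : ∫ e, e ∂ν = 0) (n : ℕ) {m : ℕ}
    (hinv : ∀ᵐ ω ∂P, IsUnit (gramMatrix (fun i => (sI i ω).1) m).det) :
    meanSquaredError P
      (fun ω => pooledEstimator (fun i : Fin n => sO i ω) (fun i : Fin m => sI i ω)) a ≤
      2 * (n + 1) * (ENNReal.ofReal (∫ e, e ^ 2 ∂ν) * expectedPrecision Q m) := by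
  have hlaw := hasLaw_triple hO hI hind hresI n m
  have hlawx : HasLaw (fun ω => (fun i => (sI i ω).1 : Fin m → EuclideanSpace ℝ (Fin p)))
      (Measure.pi fun _ => Q) P :=
    measurePreserving_fst.comp_hasLaw (measurePreserving_snd.comp_hasLaw hlaw)
  set σ := ENNReal.ofReal (∫ e, e ^ 2 ∂ν) with hσ
  set f : (Fin n → EuclideanSpace ℝ (Fin p) × ℝ) → ℝ≥0∞ := fun o =>
    ENNReal.ofReal ((fun i => outcomeResidual a (o i)) ⬝ᵥ (fun i => outcomeResidual a (o i))) with hf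
  set g : (Fin m → EuclideanSpace ℝ (Fin p)) → ℝ≥0∞ := fun x =>
    ENNReal.ofReal ((design x)ᵀ * design x)⁻¹.trace with hg
  set A : (Fin n → EuclideanSpace ℝ (Fin p) × ℝ) → (Fin m → EuclideanSpace ℝ (Fin p)) →
      Matrix (Fin p) (Fin m) ℝ := fun o x =>
    ((design fun i => (o i).1)ᵀ * (design fun i => (o i).1) +
      (design x)ᵀ * design x)⁻¹ * (design x)ᵀ with hA
  set q : (Fin n → EuclideanSpace ℝ (Fin p) × ℝ) ×
      (Fin m → EuclideanSpace ℝ (Fin p)) × (Fin m → ℝ) → ℝ≥0∞ := fun z =>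
    ENNReal.ofReal ((A z.1 z.2.1 *ᵥ z.2.2) ⬝ᵥ (A z.1 z.2.1 *ᵥ z.2.2)) with hq
  have hfm : Measurable f := by
    refine ENNReal.measurable_ofReal.comp ?_
    simp only [dotProduct]
    have := measurable_outcomeResidual a
    fun_prop
  have hgm : Measurable g := measurable_trace_inv_design
  have hqm : Measurable q := by
    have hx : Measurable fun z : (Fin n → EuclideanSpace ℝ (Fin p) × ℝ) ×
        (Fin m → EuclideanSpace ℝ (Fin p)) × (Fin m → ℝ) => fun i => (z.1 i).1 := by fun_prop
    exact measurable_quadratic_of_entries (measurable_inv_mul_transpose_of_entries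
      (fun i j => ((measurable_design_gram i j).comp hx).add
        ((measurable_design_gram i j).comp (measurable_fst.comp measurable_snd)))
      (measurable_design (measurable_fst.comp measurable_snd))) (fun j => by fun_prop)
  have hfint : ∫⁻ o, f o ∂(Measure.pi fun _ => μO) = n * σ := by
    have hpt : ∀ o, f o = ∑ i, ENNReal.ofReal (outcomeResidual a (o i) ^ 2) := fun o => by
      simp only [hf, dotProduct, ← pow_two]
      exact ENNReal.ofReal_sum_of_nonneg fun i _ => sq_nonneg _
    have hone : ∀ i : Fin n, ∫⁻ o, ENNReal.ofReal (outcomeResidual a (o i) ^ 2)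
        ∂(Measure.pi fun _ : Fin n => μO) = σ := fun i => by
      have hmp : MeasurePreserving (fun o : Fin n → EuclideanSpace ℝ (Fin p) × ℝ =>
          outcomeResidual a (o i)) (Measure.pi fun _ => μO) ν :=
        hresO.comp (measurePreserving_eval (fun _ : Fin n => μO) i)
      rw [hmp.lintegral_comp (f := fun e : ℝ => ENNReal.ofReal (e ^ 2)) (by fun_prop), hσ,
        ofReal_integral_eq_lintegral_ofReal (f := fun e : ℝ => e ^ 2) hν.integrable_sq
          (Eventually.of_forall fun e => sq_nonneg _)]
    simp only [hpt]
    rw [lintegral_finsetSum _ fun i _ => by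
      have := measurable_outcomeResidual a
      fun_prop]
    simp [hone]
  have hqint : ∫⁻ z, q z ∂((Measure.pi fun _ => μO).prod
      ((Measure.pi fun _ => Q).prod (Measure.pi fun _ => ν))) ≤ σ * expectedPrecision Q m := by
    rw [lintegral_prod _ hqm.aemeasurable]
    calc _ ≤ ∫⁻ _, σ * expectedPrecision Q m ∂(Measure.pi fun _ : Fin n => μO) := by
          refine lintegral_mono fun o => ?_
          -- With the observational sample and the interventional treatments fixed, the coefficient
          -- matrix is deterministic and only the noise is averaged.
          have hqo : Measurable fun z => q (o, z) := hqm.comp measurable_prodMk_left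
          rw [lintegral_prod _ hqo.aemeasurable]
          simp only [hq, lintegral_quadratic_pi hν h0]
          rw [lintegral_const_mul' _ _ ENNReal.ofReal_ne_top, expectedPrecision]
          refine mul_le_mul' le_rfl (lintegral_mono_ae ?_)
          filter_upwards [(hlawx.ae_iff measurable_isUnit_det_design).1 hinv] with x hx
          have hpd := posDef_transpose_mul_self hx
          exact ENNReal.ofReal_le_ofReal (trace_pooled_le _ hpd)
      _ = _ := by simp
  calc meanSquaredError P
        (fun ω => pooledEstimator (fun i : Fin n => sO i ω) (fun i : Fin m => sI i ω)) a
      ≤ ∫⁻ ω, (fun z => 2 * (f z.1 * g z.2.1) + 2 * q z)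
          ((fun i => sO i ω, fun i => (sI i ω).1, fun i => outcomeResidual a (sI i ω)) :
      (Fin n → EuclideanSpace ℝ (Fin p) × ℝ) ×
        (Fin m → EuclideanSpace ℝ (Fin p)) × (Fin m → ℝ)) ∂P := by
        refine lintegral_mono_ae ?_
        filter_upwards [hinv] with ω hω
        change IsUnit ((treatmentMatrix fun i : Fin m => sI i ω)ᵀ *
          treatmentMatrix fun i : Fin m => sI i ω).det at hω
        refine (leastSquares_fromRows_sub_le _ _ a _ _ (posDef_transpose_mul_self hω)).trans_eq ?_
        rw [outcomeVector_sub, outcomeVector_sub, mul_comm (ENNReal.ofReal _) (ENNReal.ofReal _)]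
        rfl
    _ = 2 * (n * σ * expectedPrecision Q m) + 2 * ∫⁻ z, q z ∂((Measure.pi fun _ => μO).prod
          ((Measure.pi fun _ => Q).prod (Measure.pi fun _ => ν))) := by
        rw [hlaw.lintegral_comp (f := fun z => 2 * (f z.1 * g z.2.1) + 2 * q z) (by fun_prop), lintegral_add_right _ (by fun_prop),
          lintegral_const_mul _ (by fun_prop), lintegral_const_mul _ hqm,
          lintegral_prod_mul (g := fun z : (Fin m → EuclideanSpace ℝ (Fin p)) × (Fin m → ℝ) => g z.1)
            hfm.aemeasurable (by fun_prop), hfint,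
          measurePreserving_fst.lintegral_comp hgm]
        rfl
    _ ≤ 2 * (n * σ * expectedPrecision Q m) + 2 * (σ * expectedPrecision Q m) := by gcongr
    _ = _ := by ring

end Estimation

/-! ### The residual law in the linear Gaussian model -/

namespace LinearGaussianSEM

variable {p d : ℕ} (M : LinearGaussianSEM p d)

instance : IsProbabilityMeasure M.lawZ := by unfold lawZ; infer_instance
instance : IsProbabilityMeasure M.lawNX := by unfold lawNX; infer_instance
instance : IsProbabilityMeasure M.lawNY := by unfold lawNY; infer_instance

theorem memLp_lawZ (k : Fin d) : MemLp (fun z : EuclideanSpace ℝ (Fin d) => z k) 2 M.lawZ :=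
  (EuclideanSpace.proj (𝕜 := ℝ) k).comp_memLp'
    (IsGaussian.memLp_two_id (μ := multivariateGaussian 0 M.covZ))

theorem memLp_lawNX (j : Fin p) : MemLp (fun e : EuclideanSpace ℝ (Fin p) => e j) 2 M.lawNX :=
  (EuclideanSpace.proj (𝕜 := ℝ) j).comp_memLp'
    (IsGaussian.memLp_two_id (μ := multivariateGaussian 0 M.covX))

theorem memLp_lawNY : MemLp (fun e : ℝ => e) 2 M.lawNY :=
  IsGaussian.memLp_two_id (μ := gaussianReal 0 M.varY)

theorem integral_lawZ (k : Fin d) : ∫ z, z k ∂M.lawZ = 0 := by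
  have h := (EuclideanSpace.proj (𝕜 := ℝ) k : EuclideanSpace ℝ (Fin d) →L[ℝ] ℝ).integral_comp_comm
    ((IsGaussian.memLp_two_id (μ := multivariateGaussian 0 M.covZ)).integrable one_le_two)
  simpa [lawZ] using h

/-- The contribution of the confounder and of the noise to the outcome. -/
def totalNoise (u : EuclideanSpace ℝ (Fin d) × ℝ) : ℝ := (∑ k, u.1 k * M.γ k) + u.2

theorem measurable_totalNoise : Measurable M.totalNoise := by
  unfold totalNoise
  fun_prop

/-- The law of the contribution of the confounder and of the noise to the outcome. -/
noncomputable def noiseLaw : Measure ℝ := (M.lawZ.prod M.lawNY).map M.totalNoise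

instance : IsProbabilityMeasure M.noiseLaw :=
  Measure.isProbabilityMeasure_map M.measurable_totalNoise.aemeasurable

theorem measurePreserving_totalNoise :
    MeasurePreserving M.totalNoise (M.lawZ.prod M.lawNY) M.noiseLaw :=
  ⟨M.measurable_totalNoise, rfl⟩

theorem memLp_totalNoise_confounder (k : Fin d) :
    MemLp (fun u : EuclideanSpace ℝ (Fin d) × ℝ => u.1 k * M.γ k) 2 (M.lawZ.prod M.lawNY) :=
  ((M.memLp_lawZ k).comp_measurePreserving measurePreserving_fst).mul_const _

theorem memLp_totalNoise : MemLp M.totalNoise 2 (M.lawZ.prod M.lawNY) :=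
  (memLp_finsetSum _ fun k _ => M.memLp_totalNoise_confounder k).add
    (M.memLp_lawNY.comp_measurePreserving measurePreserving_snd)

theorem memLp_noiseLaw : MemLp id 2 M.noiseLaw :=
  (memLp_map_measure_iff aestronglyMeasurable_id M.measurable_totalNoise.aemeasurable).2
    M.memLp_totalNoise

theorem integral_noiseLaw : ∫ e, e ∂M.noiseLaw = 0 := by
  rw [noiseLaw, integral_map (f := fun e : ℝ => e) M.measurable_totalNoise.aemeasurable
    aestronglyMeasurable_id]
  unfold totalNoise
  have hsnd : Integrable (fun u : EuclideanSpace ℝ (Fin d) × ℝ => u.2) (M.lawZ.prod M.lawNY) :=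
    (M.memLp_lawNY.comp_measurePreserving measurePreserving_snd).integrable one_le_two
  rw [integral_add (integrable_finsetSum _ fun k _ =>
      (M.memLp_totalNoise_confounder k).integrable one_le_two) hsnd,
    integral_finsetSum _ fun k _ => (M.memLp_totalNoise_confounder k).integrable one_le_two,
    integral_fun_snd (μ := M.lawZ) (ν := M.lawNY) (fun e : ℝ => e)]
  have h1 : ∫ e, e ∂M.lawNY = 0 := integral_id_gaussianReal
  have h2 : ∀ k, ∫ u : EuclideanSpace ℝ (Fin d) × ℝ, u.1 k * M.γ k ∂(M.lawZ.prod M.lawNY) = 0 := by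
    intro k
    rw [integral_mul_const, integral_fun_fst (μ := M.lawZ) (ν := M.lawNY)
      (fun z : EuclideanSpace ℝ (Fin d) => z k), integral_lawZ]
    simp
  simp [h1, h2]

theorem measurable_treatment : Measurable fun u : EuclideanSpace ℝ (Fin d) ×
    EuclideanSpace ℝ (Fin p) × ℝ => M.treatment u.1 u.2.1 := by
  unfold treatment
  have : Measurable fun u : EuclideanSpace ℝ (Fin d) × EuclideanSpace ℝ (Fin p) × ℝ =>
      M.B *ᵥ u.1.ofLp := by
    refine measurable_pi_lambda _ fun i => ?_
    simp only [mulVec, dotProduct]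
    fun_prop
  fun_prop

theorem measurable_obs : Measurable fun u : EuclideanSpace ℝ (Fin d) ×
    EuclideanSpace ℝ (Fin p) × ℝ =>
      (M.treatment u.1 u.2.1, M.outcome u.1 (M.treatment u.1 u.2.1) u.2.2) := by
  have := M.measurable_treatment
  unfold outcome
  fun_prop

theorem measurable_int : Measurable fun u : EuclideanSpace ℝ (Fin d) ×
    EuclideanSpace ℝ (Fin p) × ℝ => (u.2.1, M.outcome u.1 u.2.1 u.2.2) := by
  unfold outcome
  fun_prop

instance : IsProbabilityMeasure M.obsLaw :=
  Measure.isProbabilityMeasure_map M.measurable_obs.aemeasurable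

instance (Q : Measure (EuclideanSpace ℝ (Fin p))) [IsProbabilityMeasure Q] :
    IsProbabilityMeasure (M.intLaw Q) :=
  Measure.isProbabilityMeasure_map M.measurable_int.aemeasurable

/-- The treatment cancels, which is why both models share one residual law. -/
theorem outcomeResidual_outcome (z : EuclideanSpace ℝ (Fin d)) (x : EuclideanSpace ℝ (Fin p))
    (e : ℝ) : outcomeResidual M.α (x, M.outcome z x e) = M.totalNoise (z, e) := by
  simp only [outcomeResidual, outcome, totalNoise, dotProduct]
  ring

theorem measurePreserving_rearrange (Q : Measure (EuclideanSpace ℝ (Fin p)))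
    [IsProbabilityMeasure Q] :
    MeasurePreserving (fun u : EuclideanSpace ℝ (Fin d) × EuclideanSpace ℝ (Fin p) × ℝ =>
      (u.2.1, M.totalNoise (u.1, u.2.2)))
      (M.lawZ.prod (Q.prod M.lawNY)) (Q.prod M.noiseLaw) := by
  have h1 := (measurePreserving_prodAssoc M.lawZ Q M.lawNY).symm
  have h2 := (Measure.measurePreserving_swap (μ := M.lawZ) (ν := Q)).prod
    (MeasurePreserving.id M.lawNY)
  have h3 := measurePreserving_prodAssoc Q M.lawZ M.lawNY
  have h4 := (MeasurePreserving.id Q).prod M.measurePreserving_totalNoise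
  exact h4.comp (h3.comp (h2.comp h1))

theorem measurePreserving_of_comp {α β δ : Type*} [MeasurableSpace α] [MeasurableSpace β]
    [MeasurableSpace δ] {μ : Measure α} {ν : Measure δ} {f : α → β} {g : β → δ}
    (hf : Measurable f) (hg : Measurable g) (h : MeasurePreserving (g ∘ f) μ ν) :
    MeasurePreserving g (μ.map f) ν :=
  ⟨hg, by rw [Measure.map_map hg hf, h.map_eq]⟩

theorem measurePreserving_intLaw (Q : Measure (EuclideanSpace ℝ (Fin p)))
    [IsProbabilityMeasure Q] :
    MeasurePreserving (fun s => (s.1, outcomeResidual M.α s)) (M.intLaw Q)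
      (Q.prod M.noiseLaw) := by
  refine measurePreserving_of_comp M.measurable_int
    (measurable_fst.prodMk (measurable_outcomeResidual _)) ?_
  convert M.measurePreserving_rearrange Q using 1
  ext1 u
  simp [outcomeResidual_outcome]

/-- Only the marginal law is claimed: the treatment also depends on the confounder, so there is no
product structure as for `intLaw`. -/
theorem measurePreserving_obsLaw :
    MeasurePreserving (outcomeResidual M.α) M.obsLaw M.noiseLaw := by
  refine measurePreserving_of_comp M.measurable_obs (measurable_outcomeResidual _) ?_
  convert measurePreserving_snd.comp (M.measurePreserving_rearrange M.lawNX) using 1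
  ext1 u
  simp [outcomeResidual_outcome]

theorem memLp_obsLaw_treatment (j : Fin p) :
    MemLp (fun x : EuclideanSpace ℝ (Fin p) => x j) 2 (M.obsLaw.map Prod.fst) := by
  rw [obsLaw, Measure.map_map measurable_fst M.measurable_obs]
  refine (memLp_map_measure_iff (by fun_prop)
    (measurable_fst.comp M.measurable_obs).aemeasurable).2 ?_
  have h1 : MemLp (fun u : EuclideanSpace ℝ (Fin d) × EuclideanSpace ℝ (Fin p) × ℝ =>
      ∑ k, M.B j k * u.1 k) 2 (M.lawZ.prod (M.lawNX.prod M.lawNY)) :=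
    memLp_finsetSum _ fun k _ =>
      ((M.memLp_lawZ k).comp_measurePreserving measurePreserving_fst).const_mul _
  have h2 : MemLp (fun u : EuclideanSpace ℝ (Fin d) × EuclideanSpace ℝ (Fin p) × ℝ => u.2.1 j) 2
      (M.lawZ.prod (M.lawNX.prod M.lawNY)) :=
    (M.memLp_lawNX j).comp_measurePreserving (measurePreserving_fst.comp measurePreserving_snd)
  exact h1.add h2

end LinearGaussianSEM

/-! ### Rate of the bound and conclusion -/

theorem tendsto_pooled_bound {n : ℕ → ℕ}
    (hn : Tendsto (fun m : ℕ => (n m : ℝ) / (m : ℝ)) atTop (𝓝 0)) {k : ℕ} (hk : 0 < k)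
    {c : ℝ≥0∞} (hc : c ≠ ∞) :
    Tendsto (fun m : ℕ => 2 * ((n m : ℝ≥0∞) + 1) * (ENNReal.ofReal ((m / k : ℕ) : ℝ)⁻¹ * c))
      atTop (𝓝 0) := by
  have h1 : Tendsto (fun m : ℕ => 4 * (k : ℝ) * ((n m : ℝ) / m + 1 / m)) atTop (𝓝 0) := by
    simpa using (hn.add tendsto_one_div_atTop_nhds_zero_nat).const_mul (4 * (k : ℝ))
  have h2 : Tendsto (fun m : ℕ => ENNReal.ofReal (4 * (k : ℝ) * ((n m : ℝ) / m + 1 / m)) * c)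
      atTop (𝓝 0) := by
    have := ENNReal.Tendsto.mul_const (ENNReal.tendsto_ofReal h1) (Or.inr hc)
    simpa using this
  refine tendsto_of_tendsto_of_tendsto_of_le_of_le' tendsto_const_nhds h2
    (Eventually.of_forall fun _ => bot_le) ?_
  filter_upwards [eventually_ge_atTop k] with m hm
  have hmk : 0 < m / k := Nat.div_pos hm hk
  have hm0 : 0 < m := hk.trans_le hm
  have hcast : (n m : ℝ≥0∞) + 1 = ENNReal.ofReal ((n m : ℝ) + 1) := by
    rw [ENNReal.ofReal_add (by positivity) zero_le_one]; simp
  have h2cast : (2 : ℝ≥0∞) = ENNReal.ofReal 2 := by simp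
  rw [← mul_assoc, hcast, h2cast, ← ENNReal.ofReal_mul zero_le_two,
    ← ENNReal.ofReal_mul (by positivity)]
  refine mul_le_mul' (ENNReal.ofReal_le_ofReal ?_) le_rfl
  -- Since `m / k ≥ 1`, rounding down loses at most a factor two.
  have hle : (m : ℝ) ≤ 2 * k * (m / k : ℕ) := by
    have h3 : m < k * (m / k + 1) := Nat.lt_mul_div_succ m hk
    have h4 : m ≤ 2 * k * (m / k) := by nlinarith
    exact_mod_cast h4
  have hmk' : (0 : ℝ) < (m / k : ℕ) := by exact_mod_cast hmk
  have hm' : (0 : ℝ) < m := by exact_mod_cast hm0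
  have h5 : ((m / k : ℕ) : ℝ)⁻¹ ≤ 2 * k / m := by
    rw [inv_le_comm₀ hmk' (by positivity), inv_div, div_le_iff₀ (by positivity)]
    linarith
  calc 2 * ((n m : ℝ) + 1) * ((m / k : ℕ) : ℝ)⁻¹ ≤ 2 * ((n m : ℝ) + 1) * (2 * k / m) := by gcongr
    _ = 4 * (k : ℝ) * ((n m : ℝ) / m + 1 / m) := by ring

/-- The block length must be positive. An invertible Gram matrix of an empty sample forces `p = 0`,
where size one works trivially. -/
theorem exists_pos_sampleSize {p : ℕ} {Ω : Type*} [MeasurableSpace Ω] {P : Measure Ω}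
    [IsProbabilityMeasure P] {s : ℕ → Ω → EuclideanSpace ℝ (Fin p) × ℝ}
    {a : EuclideanSpace ℝ (Fin p)}
    (h : ∃ m₀ : ℕ,
      (∀ᵐ ω ∂P, IsUnit ((treatmentMatrix fun i : Fin m₀ => s i ω)ᵀ *
        treatmentMatrix fun i : Fin m₀ => s i ω).det) ∧
      meanSquaredError P (fun ω => interventionalEstimator fun i : Fin m₀ => s i ω) a < ∞) :
    ∃ m₀ : ℕ, 0 < m₀ ∧
      (∀ᵐ ω ∂P, IsUnit (gramMatrix (fun i => (s i ω).1) m₀).det) ∧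
      meanSquaredError P (fun ω => interventionalEstimator fun i : Fin m₀ => s i ω) a < ∞ := by
  obtain ⟨m₀, hinv, hmse⟩ := h
  rcases Nat.eq_zero_or_pos m₀ with rfl | hpos
  · obtain ⟨ω, hω⟩ := hinv.exists
    have hp : p = 0 := by
      by_contra hp
      have : Nonempty (Fin p) := ⟨⟨0, Nat.pos_of_ne_zero hp⟩⟩
      have h0 : (treatmentMatrix fun i : Fin 0 => s i ω)ᵀ *
          (treatmentMatrix fun i : Fin 0 => s i ω) = 0 := by
        ext i j
        simp [mul_apply]
      rw [h0, det_zero] at hω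
      simp at hω
    subst hp
    refine ⟨1, one_pos, Eventually.of_forall fun ω => by simp, ?_⟩
    have hz : ∀ v : EuclideanSpace ℝ (Fin 0), ‖v‖ₑ ^ 2 = 0 := fun v => by
      simp [Subsingleton.elim v 0]
    simp [meanSquaredError, hz]
  · exact ⟨m₀, hpos, hinv, hmse⟩

theorem proposition4p2 {p d : ℕ} (M : LinearGaussianSEM p d)
    (Q : Measure (EuclideanSpace ℝ (Fin p))) [IsProbabilityMeasure Q]
    (hQ : MemLp (fun x : EuclideanSpace ℝ (Fin p) => x) 2 Q)
    {Ω : Type*} [MeasurableSpace Ω] (P : Measure Ω) [IsProbabilityMeasure P]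
    -- the observational and the interventional samples
    (sO sI : ℕ → Ω → EuclideanSpace ℝ (Fin p) × ℝ)
    (hO : ∀ i, HasLaw (sO i) M.obsLaw P)
    (hI : ∀ i, HasLaw (sI i) (M.intLaw Q) P)
    (hindep : iIndepFun (Sum.elim sO sI : ℕ ⊕ ℕ → Ω → EuclideanSpace ℝ (Fin p) × ℝ) P)
    -- for some sample size, the interventional estimator is well defined with finite MSE
    (hfin : ∃ m₀ : ℕ,
      (∀ᵐ ω ∂P, IsUnit ((treatmentMatrix fun i : Fin m₀ => sI i ω)ᵀ *
        treatmentMatrix fun i : Fin m₀ => sI i ω).det) ∧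
      meanSquaredError P (fun ω => interventionalEstimator fun i : Fin m₀ => sI i ω) M.α < ∞)
    (n : ℕ → ℕ) (hn : Tendsto (fun m : ℕ => (n m : ℝ) / (m : ℝ)) atTop (𝓝 0)) :
    -- the pooled estimator is eventually well defined
    (∀ᶠ m : ℕ in atTop, ∀ᵐ ω ∂P,
      IsUnit ((pooledMatrix (fun i : Fin (n m) => sO i ω) (fun i : Fin m => sI i ω))ᵀ *
        pooledMatrix (fun i : Fin (n m) => sO i ω) (fun i : Fin m => sI i ω)).det) ∧
    (∀ᵐ ω ∂P, Tendsto
      (fun m : ℕ => poolingWeight (fun i : Fin (n m) => sO i ω) (fun i : Fin m => sI i ω))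
      atTop (𝓝 (1 : Matrix (Fin p) (Fin p) ℝ))) ∧
    Tendsto (fun m : ℕ => meanSquaredError P
      (fun ω => pooledEstimator (fun i : Fin (n m) => sO i ω) (fun i : Fin m => sI i ω)) M.α)
      atTop (𝓝 0) := by
  obtain ⟨k, hk, hinv, hmse⟩ := exists_pos_sampleSize hfin
  have hindO : iIndepFun sO P := hindep.precomp (g := Sum.inl) Sum.inl_injective
  have hindI : iIndepFun sI P := hindep.precomp (g := Sum.inr) Sum.inr_injective
  have hsplit := M.measurePreserving_intLaw Q
  have hxI : ∀ i, HasLaw (fun ω => (sI i ω).1) Q P := fun i =>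
    (measurePreserving_fst.comp hsplit).comp_hasLaw (hI i)
  have hxO : ∀ i, HasLaw (fun ω => (sO i ω).1) (M.obsLaw.map Prod.fst) P := fun i =>
    MeasurePreserving.comp_hasLaw ⟨measurable_fst, rfl⟩ (hO i)
  have hindxI : iIndepFun (fun i ω => (sI i ω).1) P :=
    hindI.comp (fun _ => Prod.fst) fun _ => measurable_fst
  have hindxO : iIndepFun (fun i ω => (sO i ω).1) P :=
    hindO.comp (fun _ => Prod.fst) fun _ => measurable_fst
  have hQj : ∀ j, MemLp (fun x : EuclideanSpace ℝ (Fin p) => x j) 2 Q := fun j =>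
    (EuclideanSpace.proj (𝕜 := ℝ) j).comp_memLp' hQ
  have hpd : ∀ m, k ≤ m → ∀ᵐ ω ∂P, (gramMatrix (fun i => (sI i ω).1) m).PosDef := by
    intro m hm
    filter_upwards [hinv] with ω hω
    exact gram_posDef_of_le hm (posDef_transpose_mul_self hω)
  refine ⟨?_, ?_, ?_⟩
  · filter_upwards [eventually_ge_atTop k] with m hm
    filter_upwards [hpd m hm] with ω hω
    exact isUnit_det_of_posDef (posDef_pooled _ hω)
  · have hA := isUnit_det_of_posDef (secondMoment_posDef hxI hQj hinv)
    filter_upwards [ae_tendsto_gram hxI hindxI hQj,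
      ae_tendsto_gram hxO hindxO M.memLp_obsLaw_treatment] with ω hG hH
    exact tendsto_inv_mul_of_negligible hA hG hH (by simp [gram_eq_sum]) hn
  · have hbound := tendsto_pooled_bound hn hk hmse.ne
    refine tendsto_of_tendsto_of_tendsto_of_le_of_le' tendsto_const_nhds hbound
      (Eventually.of_forall fun _ => bot_le) ?_
    filter_upwards [eventually_ge_atTop k] with m hm
    refine (meanSquaredError_pooled_le hO hI hindep M.measurePreserving_obsLaw hsplit
      M.memLp_noiseLaw M.integral_noiseLaw (n m)
      ((hpd m hm).mono fun ω hω => isUnit_det_of_posDef hω)).trans ?_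
    -- The noise variance stays multiplied by the expected precision: only this product is known to
    -- be finite, as the variance may vanish.
    rw [meanSquaredError_interventional hI hindI hsplit M.memLp_noiseLaw M.integral_noiseLaw hinv,
      mul_left_comm (ENNReal.ofReal ((m / k : ℕ) : ℝ)⁻¹)]
    gcongr
    exact expectedPrecision_le hxI hindxI hinv hk hm
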